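/- Let $m\ge 1$, $n,T\ge 0$ be integers and let $x^{(0)},\dots,x^{(T-1)}\in\mathbb R^n$ and $u^{(0)},\dots,u^{(T-1)}\in\mathbb R^m$. Let $X\in\mathbb R^{T\times n}$ and $U\in\mathbb R^{T\times m}$ be the matrices with rows $x^{(k)}$ and $u^{(k)}$, and let $\tilde X,\tilde U$ be obtained from them by dividing each column by its $\ell_1$ norm (a zero column is left unchanged). Define the zonotope $$\mathcal Z:=[\tilde X\ \ \tilde U]^\top\mathcal B_\infty\subseteq\mathbb R^n\times\mathbb R^m,\qquad \mathcal B_\infty:=\{z\in\mathbb R^T:\|z\|_\infty\le 1\}.$$ Say that $(x,u)$ is persistently scattering if there is a nonsingular diagonal matrix $D\in\mathbb R^{(n+m)\times(n+m)}$ such that $D\mathcal B_2\subseteq\mathcal Z$ and $D\mathcal B_2\cap\partial\mathcal Z=\{(0,\pm e_i): 1\le i\le m\}$, where $\mathcal B_2$ is the closed Euclidean unit ball of $\mathbb R^n\times\mathbb R^m$ and $e_1,\dots,e_m$ is the standard basis of $\mathbb R^m$. For $w\in\mathbb R^n$, $v\in\mathbb R^m$ put $$\sigma_{\mathcal Z}(w,v):=\sup_{(a,b)\in\mathcal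 Z}\big(\langle a,w\rangle+\langle b,v\rangle\big)=\|\tilde Xw+\tilde Uv\|_1,\qquad \Omega(v):=\inf_{w\in\mathbb R^n}\sigma_{\mathcal Z}(w,v).$$ Then $(x,u)$ is persistently scattering if and only if the following three conditions hold simultaneously: 1. $\Omega(v)\ge\|v\|_2$ for all $v\in\mathbb R^m$; 2. for all $v\in\mathbb R^m$, $\Omega(v)=\|v\|_2$ if and only if $v$ has at most one nonzero entry; 3. for every $i\in\{1,\dots,m\}$ and every $w\in\mathbb R^n$, $\Omega(e_i)=\sigma_{\mathcal Z}(w,e_i)$ implies $w=0$. -/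

import Mathlib

open scoped Matrix

noncomputable section

namespace PersistentScattering

/-- The `ℓ₁` norm of a real vector with finitely many entries. -/
def l1Norm {ι : Type*} [Fintype ι] (a : ι → ℝ) : ℝ :=
  ‖(WithLp.toLp 1 a : PiLp 1 fun _ : ι => ℝ)‖

/-- The number of nonzero entries `‖v‖₀` of a vector. -/
def l0 {m : ℕ} (v : EuclideanSpace ℝ (Fin m)) : ℕ :=
  {i : Fin m | v i ≠ 0}.ncard

/-- The `T × k` matrix whose rows are the samples `y⁽⁰⁾, …, y⁽ᵀ⁻¹⁾`. -/
def dataMatrix {T k : ℕ} (y : Fin T → EuclideanSpace ℝ (Fin k)) : Matrix (Fin T) (Fin k) ℝ :=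
  Matrix.of fun t i => y t i

/-- Every column is divided by its `ℓ₁` norm (a zero column stays zero). -/
def colNormalize {T k : ℕ} (M : Matrix (Fin T) (Fin k) ℝ) : Matrix (Fin T) (Fin k) ℝ :=
  Matrix.of fun t i => M t i / l1Norm (fun s => M s i)

/-- The point `(a, b)` of `ℝⁿ × ℝᵐ`, with its Euclidean structure. -/
def pair {n m : ℕ} (a : EuclideanSpace ℝ (Fin n)) (b : EuclideanSpace ℝ (Fin m)) :
    EuclideanSpace ℝ (Fin n ⊕ Fin m) :=
  WithLp.toLp 2 (Sum.elim a b)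

/-- The normalized data matrix `[X̃ Ũ]` of `(x, u)`. -/
def normalizedData {T n m : ℕ} (x : Fin T → EuclideanSpace ℝ (Fin n))
    (u : Fin T → EuclideanSpace ℝ (Fin m)) : Matrix (Fin T) (Fin n ⊕ Fin m) ℝ :=
  Matrix.fromCols (colNormalize (dataMatrix x)) (colNormalize (dataMatrix u))

/-- The fundamental zonotope `𝒵 = [X̃ Ũ]ᵀ ℬ_∞` of `(x, u)`, where `ℬ_∞ ⊆ ℝᵀ` is the closed unit
ball of the sup norm (the norm of `Fin T → ℝ`). -/
def zonotope {T n m : ℕ} (x : Fin T → EuclideanSpace ℝ (Fin n))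
    (u : Fin T → EuclideanSpace ℝ (Fin m)) : Set (EuclideanSpace ℝ (Fin n ⊕ Fin m)) :=
  (fun z : Fin T → ℝ => WithLp.toLp 2 ((normalizedData x u)ᵀ *ᵥ z)) '' Metric.closedBall 0 1

/-- `(x, u)` is persistently scattering: for some nonsingular diagonal `D`, the ellipsoid `D ℬ₂`
lies in the fundamental zonotope and meets its boundary exactly in the points `(0, ±eᵢ)`. -/
def PersistentlyScattering {T n m : ℕ} (x : Fin T → EuclideanSpace ℝ (Fin n))
    (u : Fin T → EuclideanSpace ℝ (Fin m)) : Prop :=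
  ∃ D : Matrix (Fin n ⊕ Fin m) (Fin n ⊕ Fin m) ℝ, D.IsDiag ∧ IsUnit D ∧
    Matrix.toEuclideanLin D '' Metric.closedBall 0 1 ⊆ zonotope x u ∧
    (Matrix.toEuclideanLin D '' Metric.closedBall 0 1) ∩ frontier (zonotope x u) =
      {p | ∃ i : Fin m, p = pair 0 (EuclideanSpace.single i 1) ∨
        p = pair 0 (-EuclideanSpace.single i 1)}

/-- The support function of the fundamental zonotope,
`σ(w, v) = sup_{(a, b) ∈ 𝒵} (⟨a, w⟩ + ⟨b, v⟩)`. -/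
def sigma {T n m : ℕ} (x : Fin T → EuclideanSpace ℝ (Fin n))
    (u : Fin T → EuclideanSpace ℝ (Fin m))
    (w : EuclideanSpace ℝ (Fin n)) (v : EuclideanSpace ℝ (Fin m)) : ℝ :=
  sSup ((fun p => inner ℝ p (pair w v)) '' zonotope x u)

/-- `Ω(v) = inf_w σ(w, v)`. -/
def Omega {T n m : ℕ} (x : Fin T → EuclideanSpace ℝ (Fin n))
    (u : Fin T → EuclideanSpace ℝ (Fin m)) (v : EuclideanSpace ℝ (Fin m)) : ℝ :=
  ⨅ w : EuclideanSpace ℝ (Fin n), sigma x u w v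

theorem inner_zonotope_point {T n m : ℕ} (x : Fin T → EuclideanSpace ℝ (Fin n))
    (u : Fin T → EuclideanSpace ℝ (Fin m)) (w : EuclideanSpace ℝ (Fin n))
    (v : EuclideanSpace ℝ (Fin m)) (z : Fin T → ℝ) :
    inner ℝ (WithLp.toLp 2 ((normalizedData x u)ᵀ *ᵥ z)) (pair w v) =
      ∑ t, z t * (colNormalize (dataMatrix x) *ᵥ w + colNormalize (dataMatrix u) *ᵥ v) t := by
  have h : inner ℝ (WithLp.toLp 2 ((normalizedData x u)ᵀ *ᵥ z)) (pair w v) =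
      ((normalizedData x u)ᵀ *ᵥ z) ⬝ᵥ Sum.elim w v := by
    simp [pair, PiLp.inner_apply, dotProduct, mul_comm]
  rw [h, Matrix.mulVec_transpose, ← Matrix.dotProduct_mulVec, normalizedData,
    Matrix.fromCols_mulVec]
  simp [dotProduct]

/-- The supremum defining `σ(w, v)` is attained, and `σ(w, v) = ‖X̃ w + Ũ v‖₁`. -/
theorem sigma_isGreatest {T n m : ℕ} (x : Fin T → EuclideanSpace ℝ (Fin n))
    (u : Fin T → EuclideanSpace ℝ (Fin m))
    (w : EuclideanSpace ℝ (Fin n)) (v : EuclideanSpace ℝ (Fin m)) :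
    IsGreatest ((fun p => inner ℝ p (pair w v)) '' zonotope x u)
      (l1Norm (colNormalize (dataMatrix x) *ᵥ w + colNormalize (dataMatrix u) *ᵥ v)) := by
  set c := colNormalize (dataMatrix x) *ᵥ w + colNormalize (dataMatrix u) *ᵥ v with hc
  have hl : l1Norm c = ∑ t, |c t| := by
    simp [l1Norm, PiLp.norm_eq_of_L1]
  constructor
  · refine ⟨_, ⟨fun t => (SignType.sign (c t) : ℝ), ?_, rfl⟩, ?_⟩
    · rw [mem_closedBall_zero_iff, pi_norm_le_iff_of_nonneg zero_le_one]
      intro t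
      rcases lt_trichotomy (c t) 0 with h | h | h <;> simp [h]
    · simp only [inner_zonotope_point, ← hc, hl, sign_mul_self]
  · rintro _ ⟨_, ⟨z, hz, rfl⟩, rfl⟩
    simp only [inner_zonotope_point, ← hc, hl]
    refine Finset.sum_le_sum fun t _ => ?_
    rw [mem_closedBall_zero_iff, pi_norm_le_iff_of_nonneg zero_le_one] at hz
    calc z t * c t ≤ |z t * c t| := le_abs_self _
      _ = |z t| * |c t| := abs_mul _ _
      _ ≤ 1 * |c t| := mul_le_mul_of_nonneg_right (hz t) (abs_nonneg _)
      _ = |c t| := one_mul _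

theorem sigma_eq_l1Norm {T n m : ℕ} (x : Fin T → EuclideanSpace ℝ (Fin n))
    (u : Fin T → EuclideanSpace ℝ (Fin m))
    (w : EuclideanSpace ℝ (Fin n)) (v : EuclideanSpace ℝ (Fin m)) :
    sigma x u w v =
      l1Norm (colNormalize (dataMatrix x) *ᵥ w + colNormalize (dataMatrix u) *ᵥ v) :=
  (sigma_isGreatest x u w v).csSup_eq

end PersistentScattering

end

/-!
Everything is expressed through the support function `S(w, v) = σ(w, v) = ‖X̃ w + Ũ v‖₁`, a seminorm
on `ℝⁿ × ℝᵐ`. By Hahn–Banach, `D ℬ₂ ⊆ 𝒵` means `‖D q‖ ≤ S q` for all `q`, and the contact points of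
`D ℬ₂` with `∂𝒵` are the points `D² q / ‖D q‖` for the nonzero `q` with `‖D q‖ = S q`
(`mem_image_closedBall_inter_frontier_iff`). So persistence of scattering
becomes a condition on the inequality `‖D q‖ ≤ S q` and its equality cases
(`persistentlyScattering_iff`).

Necessity: contact at `(0, eᵢ)` forces the entry of `D` at this coordinate to be `±1`, and
`S(0, eᵢ) = 1`. With the remaining entries `d₁, …, dₙ` of `D`, the inequality reads
`S(w, v)² ≥ ∑ dⱼ² wⱼ² + ‖v‖²`, and an equality `S(w, v) = ‖v‖` implies `w = 0`. The infimum
`Ω(v)` is attained, so `Ω(v) = ‖v‖` with `v ≠ 0` makes `(0, v / ‖v‖)` a contact point.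

Sufficiency: as the columns are normalized, `S(0, eᵢ) ≤ 1`, and the three conditions yield
`S(0, eᵢ) = 1` and `S(w, v) > ‖v‖` off the axes `ℝ (0, eᵢ)`. The point is to improve this to
`S(w, v)² ≥ ‖v‖² + δ ‖w‖²` for some `δ > 0` (`exists_quadratic_margin`);
then `D = diag(√(δ/2), …, 1, …)` works. Off neighbourhoods of the axes this is compactness of the
unit sphere. Near an axis, both sides are nearly equal, and what helps is that `S` is polyhedral:
a strict minimum of a polyhedral function is sharp, so that `S` grows linearly away from the axis
(`exists_linear_growth`), while `‖v‖² + δ ‖w‖²` grows quadratically.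
-/

namespace PersistentScattering

/-! ### Inscribed ellipsoids and support functions -/

section SupportFunction

variable {E : Type*} [NormedAddCommGroup E] [InnerProductSpace ℝ E] [FiniteDimensional ℝ E]
  {Z : Set E} {S : Seminorm ℝ E}

theorem mem_iff_forall_inner_le (hconv : Convex ℝ Z) (hclosed : IsClosed Z)
    (hS : ∀ q, IsGreatest ((fun p => inner ℝ p q) '' Z) (S q)) {p : E} :
    p ∈ Z ↔ ∀ q, inner ℝ p q ≤ S q := by
  refine ⟨fun hp q => (hS q).2 ⟨p, hp, rfl⟩, fun h => ?_⟩
  by_contra hp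
  obtain ⟨f, r, hf, hr⟩ := geometric_hahn_banach_closed_point hconv hclosed hp
  set q := (InnerProductSpace.toDual ℝ E).symm f
  have hq : ∀ a, f a = inner ℝ a q := fun a => by
    rw [real_inner_comm, InnerProductSpace.toDual_symm_apply]
  obtain ⟨a, ha, haq⟩ := (hS q).1
  have h1 := hf a ha
  have h2 := h q
  simp only at haq
  rw [hq] at h1 hr
  linarith

/-- A point of `Z` is on its boundary iff some nonzero functional attains its maximum over `Z`
there. If no functional does, the gap `S q - ⟪p, q⟫` is bounded below on the unit sphere, and `Z`
contains a ball around `p`. -/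
theorem mem_frontier_iff_exists_inner_eq (hconv : Convex ℝ Z) (hclosed : IsClosed Z)
    (hS : ∀ q, IsGreatest ((fun p => inner ℝ p q) '' Z) (S q)) {p : E} (hp : p ∈ Z) :
    p ∈ frontier Z ↔ ∃ q, q ≠ 0 ∧ inner ℝ p q = S q := by
  rw [frontier, hclosed.closure_eq, Set.mem_sdiff, and_iff_right hp]
  have hle := fun {p : E} => mem_iff_forall_inner_le (p := p) hconv hclosed hS
  constructor
  · intro hint
    by_contra! hne
    apply hint
    have hcont : Continuous S := by
      have := (S.convexOn.continuousOn isOpen_univ)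
      exact continuousOn_univ.1 this
    obtain ⟨ε, hε, hgap⟩ := (isCompact_sphere (0 : E) 1).exists_forall_le' (a := 0)
      (f := fun q => S q - inner ℝ p q) (by fun_prop) (fun q hq => by
        have hq0 : q ≠ 0 := ne_zero_of_mem_unit_sphere ⟨q, hq⟩
        exact sub_pos.2 (lt_of_le_of_ne (hle.1 hp q) (hne q hq0)))
    rw [mem_interior_iff_mem_nhds, Metric.mem_nhds_iff]
    refine ⟨ε, hε, fun a ha => hle.2 fun q => ?_⟩
    rcases eq_or_ne q 0 with rfl | hq
    · simp
    have hq' : 0 < ‖q‖ := norm_pos_iff.2 hq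
    have h1 := hgap (‖q‖⁻¹ • q) (by simp [norm_smul, hq'.ne'])
    simp only [map_smul_eq_mul, inner_smul_right, norm_inv, norm_norm, ← mul_sub] at h1
    rw [inv_mul_eq_div, le_div_iff₀ hq'] at h1
    have h2 : inner ℝ (a - p) q ≤ ‖a - p‖ * ‖q‖ := real_inner_le_norm _ _
    rw [inner_sub_left] at h2
    rw [Metric.mem_ball, dist_eq_norm] at ha
    nlinarith
  · rintro ⟨q, hq, hpq⟩ hint
    have hcont : Filter.Tendsto (fun t : ℝ => p + t • q) (nhdsWithin 0 (Set.Ioi 0)) (nhds p) := by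
      have : Continuous fun t : ℝ => p + t • q := by fun_prop
      simpa using (this.tendsto 0).mono_left nhdsWithin_le_nhds
    obtain ⟨t, htZ, ht⟩ := ((hcont.eventually (mem_interior_iff_mem_nhds.1 hint)).and
      self_mem_nhdsWithin).exists
    have h1 := hle.1 htZ q
    rw [inner_add_left, inner_smul_left, real_inner_self_eq_norm_sq] at h1
    have h2 : 0 < t * ‖q‖ ^ 2 := mul_pos ht (by positivity)
    simp at h1
    linarith

/-- The ellipsoid `L ℬ₂` has the support function `q ↦ ‖L q‖`. -/
theorem image_closedBall_subset_iff (hconv : Convex ℝ Z) (hclosed : IsClosed Z)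
    (hS : ∀ q, IsGreatest ((fun p => inner ℝ p q) '' Z) (S q))
    {L : E →ₗ[ℝ] E} (hL : L.IsSymmetric) :
    L '' Metric.closedBall 0 1 ⊆ Z ↔ ∀ q, ‖L q‖ ≤ S q := by
  constructor
  · intro h q
    rcases eq_or_ne (L q) 0 with h0 | h0
    · simp [h0]
    have h1 : L (‖L q‖⁻¹ • L q) ∈ Z := h ⟨_, by simp [norm_smul, h0], rfl⟩
    have h2 := (mem_iff_forall_inner_le hconv hclosed hS).1 h1 q
    rw [hL, inner_smul_left, real_inner_self_eq_norm_sq] at h2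
    have h3 : ‖L q‖ ≠ 0 := norm_ne_zero_iff.2 h0
    calc ‖L q‖ = ‖L q‖⁻¹ * ‖L q‖ ^ 2 := by field_simp
      _ ≤ S q := by simpa using h2
  · rintro h _ ⟨a, ha, rfl⟩
    refine (mem_iff_forall_inner_le hconv hclosed hS).2 fun q => ?_
    rw [hL]
    calc inner ℝ a (L q) ≤ ‖a‖ * ‖L q‖ := real_inner_le_norm _ _
      _ ≤ 1 * ‖L q‖ := by gcongr; simpa using ha
      _ ≤ S q := by simpa using h q

/-- The contact points of an inscribed ellipsoid `L ℬ₂` with the boundary of `Z` correspond to the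
directions `q` in which the two support functions agree: the contact point is the unique point of
the ellipsoid that is extreme in the direction `q`. -/
theorem mem_image_closedBall_inter_frontier_iff (hconv : Convex ℝ Z) (hclosed : IsClosed Z)
    (hS : ∀ q, IsGreatest ((fun p => inner ℝ p q) '' Z) (S q))
    {L : E →ₗ[ℝ] E} (hL : L.IsSymmetric) (hinj : Function.Injective L)
    (hle : ∀ q, ‖L q‖ ≤ S q) {p : E} :
    p ∈ (L '' Metric.closedBall 0 1) ∩ frontier Z ↔
      ∃ q, q ≠ 0 ∧ S q = ‖L q‖ ∧ p = ‖L q‖⁻¹ • L (L q) := by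
  have hsub := (image_closedBall_subset_iff hconv hclosed hS hL).2 hle
  have hpos : ∀ {q}, q ≠ 0 → 0 < ‖L q‖ := fun {q} hq =>
    norm_pos_iff.2 fun h => hq (hinj (by simpa using h))
  constructor
  · rintro ⟨⟨a, ha, rfl⟩, hfr⟩
    obtain ⟨q, hq, hpq⟩ :=
      (mem_frontier_iff_exists_inner_eq hconv hclosed hS (hsub ⟨a, ha, rfl⟩)).1 hfr
    have hq' := hpos hq
    rw [mem_closedBall_zero_iff] at ha
    rw [hL] at hpq
    have h1 : inner ℝ a (L q) ≤ ‖a‖ * ‖L q‖ := real_inner_le_norm _ _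
    have h2 : S q = ‖L q‖ := le_antisymm (by nlinarith) (hle q)
    refine ⟨q, hq, h2, ?_⟩
    rw [← map_smul]
    congr 1
    rw [← sub_eq_zero, ← norm_eq_zero, ← sq_eq_zero_iff]
    refine le_antisymm ?_ (sq_nonneg _)
    have h3 : ‖L q‖⁻¹ * ‖L q‖ = 1 := inv_mul_cancel₀ hq'.ne'
    rw [norm_sub_sq_real, inner_smul_right, hpq, h2, norm_smul, norm_inv, norm_norm, h3]
    nlinarith [norm_nonneg a]
  · rintro ⟨q, hq, hSq, rfl⟩
    have hq' := hpos hq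
    have hmem : ‖L q‖⁻¹ • L (L q) ∈ L '' Metric.closedBall 0 1 :=
      ⟨‖L q‖⁻¹ • L q, by simp [norm_smul, hq'.ne'], map_smul _ _ _⟩
    refine ⟨hmem, (mem_frontier_iff_exists_inner_eq hconv hclosed hS (hsub hmem)).2 ⟨q, hq, ?_⟩⟩
    rw [inner_smul_left, hL, real_inner_self_eq_norm_sq, hSq]
    simp
    field_simp

end SupportFunction

/-! ### Sharpness of strict minima of polyhedral functions -/

/-- A polyhedral function `∑ |fₜ|` that is strictly minimal at `e` along the subspace `H` grows at
least linearly away from `e`. Near `e` it coincides with its value at `e` plus its directional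
derivative, which is positively homogeneous and positive on `H`, hence bounded below by a
multiple of the norm; by convexity the resulting bound holds globally. -/
theorem exists_linear_growth {ι E : Type*} [Fintype ι] [NormedAddCommGroup E] [NormedSpace ℝ E]
    [FiniteDimensional ℝ E] (f : ι → E →L[ℝ] ℝ) (e : E) (H : Submodule ℝ E)
    (hmin : ∀ q ∈ H, q ≠ 0 → ∑ t, |f t e| < ∑ t, |f t (e + q)|) :
    ∃ c > 0, ∀ s : ℝ, ∀ q ∈ H, s * ∑ t, |f t e| + c * ‖q‖ ≤ ∑ t, |f t (s • e + q)| := by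
  -- the directional derivative at `e` of `|f t|` in the direction `q`
  let g : ι → E → ℝ := fun t q =>
    if f t e = 0 then |f t q| else (SignType.sign (f t e) : ℝ) * f t q
  have hg_cont : ∀ t, Continuous (g t) := fun t => by
    by_cases h : f t e = 0 <;> simp only [g, h, if_true, if_false] <;> fun_prop
  have hg_smul : ∀ t (r : ℝ) q, 0 ≤ r → g t (r • q) = r * g t q := fun t r q hr => by
    by_cases h : f t e = 0
    · simp [g, h, abs_mul, abs_of_nonneg hr]
    · simp only [g, h, if_false, map_smul, smul_eq_mul]; ring
  have hg_le : ∀ t (s : ℝ) q, s * |f t e| + g t q ≤ |f t (s • e + q)| := fun t s q => by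
    rcases lt_trichotomy (f t e) 0 with h | h | h
    · have := neg_abs_le (s * f t e + f t q)
      simp [g, h, h.ne, abs_of_neg h]
      linarith
    · simp [g, h]
    · have := le_abs_self (s * f t e + f t q)
      simp [g, h, h.ne', abs_of_pos h]
      linarith
  have hg_eq : ∀ t q, ∀ᶠ r : ℝ in nhdsWithin 0 (Set.Ioi 0),
      |f t (e + r • q)| = |f t e| + g t (r • q) := fun t q => by
    have hlim : Filter.Tendsto (fun r : ℝ => f t (e + r • q)) (nhdsWithin 0 (Set.Ioi 0))
        (nhds (f t e)) := by
      have : Continuous fun r : ℝ => f t (e + r • q) := by fun_prop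
      simpa using (this.tendsto 0).mono_left nhdsWithin_le_nhds
    rcases lt_trichotomy (f t e) 0 with h | h | h
    · filter_upwards [hlim.eventually_lt_const h] with r hr
      rw [abs_of_neg hr]
      simp [g, h, h.ne, abs_of_neg h]
      ring
    · simp [g, h]
    · filter_upwards [hlim.eventually_const_lt h] with r hr
      rw [abs_of_pos hr]
      simp [g, h, h.ne', abs_of_pos h]
  have hg_pos : ∀ q ∈ H, q ≠ 0 → 0 < ∑ t, g t q := fun q hq hq0 => by
    obtain ⟨r, hr, hr0⟩ := ((Filter.eventually_all.2 fun t => hg_eq t q).and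
      self_mem_nhdsWithin).exists
    have hr0 : 0 < r := hr0
    have h1 := hmin (r • q) (H.smul_mem r hq) (smul_ne_zero hr0.ne' hq0)
    simp only [hr, Finset.sum_add_distrib, hg_smul _ _ _ hr0.le, ← Finset.mul_sum] at h1
    exact pos_of_mul_pos_right (by linarith) hr0.le
  obtain ⟨c, hc, hgc⟩ := ((isCompact_sphere (0 : E) 1).inter_right
    H.closed_of_finiteDimensional).exists_forall_le' (a := 0) (f := fun q => ∑ t, g t q)
    (by fun_prop) (fun q hq => hg_pos q hq.2 (ne_zero_of_mem_unit_sphere ⟨q, hq.1⟩))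
  refine ⟨c, hc, fun s q hq => ?_⟩
  have hcq : c * ‖q‖ ≤ ∑ t, g t q := by
    rcases eq_or_ne q 0 with rfl | hq0
    · simp [g]
    have hq' : 0 < ‖q‖ := norm_pos_iff.2 hq0
    have h1 := hgc (‖q‖⁻¹ • q) ⟨by simp [norm_smul, hq'.ne'], H.smul_mem _ hq⟩
    simp only [hg_smul _ _ _ (inv_nonneg.2 hq'.le), ← Finset.mul_sum] at h1
    rwa [inv_mul_eq_div, le_div_iff₀ hq'] at h1
  calc s * ∑ t, |f t e| + c * ‖q‖ ≤ ∑ t, (s * |f t e| + g t q) := by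
        rw [Finset.sum_add_distrib, Finset.mul_sum]; gcongr
    _ ≤ _ := Finset.sum_le_sum fun t _ => hg_le t s q

/-! ### Coordinates and diagonal maps -/

section Coordinates

variable {n m : ℕ}

@[simp] theorem pair_inl (w : EuclideanSpace ℝ (Fin n)) (v : EuclideanSpace ℝ (Fin m))
    (j : Fin n) : pair w v (Sum.inl j) = w j := rfl

@[simp] theorem pair_inr (w : EuclideanSpace ℝ (Fin n)) (v : EuclideanSpace ℝ (Fin m))
    (i : Fin m) : pair w v (Sum.inr i) = v i := rfl

theorem exists_eq_pair (p : EuclideanSpace ℝ (Fin n ⊕ Fin m)) : ∃ w v, p = pair w v :=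
  ⟨WithLp.toLp 2 fun j => p (Sum.inl j), WithLp.toLp 2 fun i => p (Sum.inr i), by
    ext (j | i) <;> rfl⟩

theorem pair_add (w w' : EuclideanSpace ℝ (Fin n)) (v v' : EuclideanSpace ℝ (Fin m)) :
    pair (w + w') (v + v') = pair w v + pair w' v' := by
  ext (j | i) <;> simp

theorem smul_pair (r : ℝ) (w : EuclideanSpace ℝ (Fin n)) (v : EuclideanSpace ℝ (Fin m)) :
    r • pair w v = pair (r • w) (r • v) := by
  ext (j | i) <;> simp

@[simp] theorem pair_zero_zero :
    pair (0 : EuclideanSpace ℝ (Fin n)) (0 : EuclideanSpace ℝ (Fin m)) = 0 := by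
  ext (j | i) <;> simp

theorem norm_pair_sq (w : EuclideanSpace ℝ (Fin n)) (v : EuclideanSpace ℝ (Fin m)) :
    ‖pair w v‖ ^ 2 = ‖w‖ ^ 2 + ‖v‖ ^ 2 := by
  simp [EuclideanSpace.real_norm_sq_eq, Fintype.sum_sum_type]

theorem continuous_pair_left (v : EuclideanSpace ℝ (Fin m)) :
    Continuous fun w : EuclideanSpace ℝ (Fin n) => pair w v := by
  refine (PiLp.continuous_toLp 2 _).comp (continuous_pi fun k => ?_)
  rcases k with j | i
  · simp only [Sum.elim_inl]; fun_prop
  · simp only [Sum.elim_inr]; fun_prop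

/-- A vector with at most one nonzero entry is a multiple of a standard basis vector; some basis
vector is needed even for `v = 0`, hence `0 < m`. -/
theorem l0_le_one_iff (hm : 0 < m) (v : EuclideanSpace ℝ (Fin m)) :
    l0 v ≤ 1 ↔ ∃ (i : Fin m) (c : ℝ), v = c • EuclideanSpace.single i 1 := by
  rw [l0, Set.ncard_le_one_iff (Set.toFinite _)]
  constructor
  · intro h
    by_cases hv : ∃ i, v i ≠ 0
    · obtain ⟨i, hi⟩ := hv
      refine ⟨i, v i, ?_⟩
      ext k
      by_cases hk : k = i
      · simp [hk]
      · have : v k = 0 := by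
          by_contra hvk
          exact hk (h hvk hi)
        simp [hk, this]
    · push Not at hv
      exact ⟨⟨0, hm⟩, 0, by ext k; simp [hv k]⟩
  · rintro ⟨i, c, rfl⟩ a b ha hb
    have key : ∀ {k}, (c • EuclideanSpace.single i (1 : ℝ) : EuclideanSpace ℝ (Fin m)) k ≠ 0 →
        k = i := fun {k} hk => by
      by_contra hne
      simp [hne] at hk
    rw [key ha, key hb]

theorem toEuclideanLin_diagonal_apply {ι : Type*} [Fintype ι] [DecidableEq ι] (d : ι → ℝ)
    (p : EuclideanSpace ℝ ι) (k : ι) :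
    Matrix.toEuclideanLin (Matrix.diagonal d) p k = d k * p k := by
  simp [Matrix.toLpLin_apply, Matrix.mulVec_diagonal]

theorem isSymmetric_toEuclideanLin_diagonal {ι : Type*} [Fintype ι] [DecidableEq ι]
    (d : ι → ℝ) : (Matrix.toEuclideanLin (Matrix.diagonal d)).IsSymmetric := fun p q => by
  simp [PiLp.inner_apply, toEuclideanLin_diagonal_apply, mul_left_comm, mul_assoc]

theorem injective_toEuclideanLin_diagonal {ι : Type*} [Fintype ι] [DecidableEq ι] {d : ι → ℝ}
    (hd : ∀ k, d k ≠ 0) : Function.Injective (Matrix.toEuclideanLin (Matrix.diagonal d)) :=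
  fun p q h => by
    ext k
    have := congrArg (fun r => r k) h
    simpa [toEuclideanLin_diagonal_apply, hd k] using this

theorem norm_toEuclideanLin_diagonal_pair_sq (d : Fin n ⊕ Fin m → ℝ)
    (w : EuclideanSpace ℝ (Fin n)) (v : EuclideanSpace ℝ (Fin m)) :
    ‖Matrix.toEuclideanLin (Matrix.diagonal d) (pair w v)‖ ^ 2 =
      ∑ j, d (Sum.inl j) ^ 2 * w j ^ 2 + ∑ i, d (Sum.inr i) ^ 2 * v i ^ 2 := by
  simp [EuclideanSpace.real_norm_sq_eq, Fintype.sum_sum_type, toEuclideanLin_diagonal_apply,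
    mul_pow]

end Coordinates

/-! ### The zonotope and its support function -/

noncomputable section

variable {T n m : ℕ} (x : Fin T → EuclideanSpace ℝ (Fin n))
  (u : Fin T → EuclideanSpace ℝ (Fin m))

/-- The functional `p ↦ ([X̃ Ũ] p)ₜ`, the `t`-th generator of the zonotope seen as a functional. -/
def generator (t : Fin T) : EuclideanSpace ℝ (Fin n ⊕ Fin m) →L[ℝ] ℝ :=
  LinearMap.toContinuousLinearMap
    (LinearMap.proj t ∘ₗ (normalizedData x u).mulVecLin ∘ₗ
      (WithLp.linearEquiv 2 ℝ (Fin n ⊕ Fin m → ℝ)).toLinearMap)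

/-- The support function of the zonotope on the whole space, as the seminorm
`p ↦ ‖[X̃ Ũ] p‖₁`. -/
def dataSeminorm : Seminorm ℝ (EuclideanSpace ℝ (Fin n ⊕ Fin m)) :=
  Seminorm.of (fun p => ∑ t, |generator x u t p|)
    (fun p q => by
      simp only [map_add, ← Finset.sum_add_distrib]
      exact Finset.sum_le_sum fun t _ => abs_add_le _ _)
    (fun r p => by simp [abs_mul, Finset.mul_sum])

theorem dataSeminorm_apply (p : EuclideanSpace ℝ (Fin n ⊕ Fin m)) :
    dataSeminorm x u p = ∑ t, |generator x u t p| := rfl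

theorem generator_pair (t : Fin T) (w : EuclideanSpace ℝ (Fin n))
    (v : EuclideanSpace ℝ (Fin m)) :
    generator x u t (pair w v) =
      (colNormalize (dataMatrix x) *ᵥ w + colNormalize (dataMatrix u) *ᵥ v) t := by
  change (normalizedData x u *ᵥ Sum.elim w v) t = _
  rw [normalizedData, Matrix.fromCols_mulVec]
  simp

theorem l1Norm_eq_sum {ι : Type*} [Fintype ι] (a : ι → ℝ) : l1Norm a = ∑ t, |a t| := by
  simp [l1Norm, PiLp.norm_eq_of_L1]

theorem sigma_eq_dataSeminorm (w : EuclideanSpace ℝ (Fin n)) (v : EuclideanSpace ℝ (Fin m)) :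
    sigma x u w v = dataSeminorm x u (pair w v) := by
  simp only [sigma_eq_l1Norm, l1Norm_eq_sum, dataSeminorm_apply, generator_pair]

theorem isGreatest_dataSeminorm (q : EuclideanSpace ℝ (Fin n ⊕ Fin m)) :
    IsGreatest ((fun p => inner ℝ p q) '' zonotope x u) (dataSeminorm x u q) := by
  obtain ⟨w, v, rfl⟩ := exists_eq_pair q
  rw [← sigma_eq_dataSeminorm, sigma_eq_l1Norm]
  exact sigma_isGreatest x u w v

theorem continuous_dataSeminorm : Continuous (dataSeminorm x u) := by
  have : ⇑(dataSeminorm x u) = fun p => ∑ t, |generator x u t p| := rfl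
  rw [this]
  fun_prop

theorem zonotope_eq_image : zonotope x u =
    ((WithLp.linearEquiv 2 ℝ (Fin n ⊕ Fin m → ℝ)).symm.toLinearMap ∘ₗ
      (normalizedData x u)ᵀ.mulVecLin) '' Metric.closedBall 0 1 := rfl

theorem convex_zonotope : Convex ℝ (zonotope x u) := by
  rw [zonotope_eq_image]
  exact (convex_closedBall _ _).linear_image _

theorem isClosed_zonotope : IsClosed (zonotope x u) := by
  rw [zonotope_eq_image]
  exact ((isCompact_closedBall _ _).image (LinearMap.continuous_of_finiteDimensional _)).isClosed

theorem Omega_le_dataSeminorm (w : EuclideanSpace ℝ (Fin n)) (v : EuclideanSpace ℝ (Fin m)) :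
    Omega x u v ≤ dataSeminorm x u (pair w v) := by
  rw [← sigma_eq_dataSeminorm]
  refine ciInf_le ⟨0, ?_⟩ w
  rintro _ ⟨w, rfl⟩
  simp only [sigma_eq_dataSeminorm]
  exact apply_nonneg _ _

/-- The normalization of the columns enters only here: a column of `Ũ` has `ℓ₁` norm `1`, or `0`
if the column of `U` is zero. -/
theorem dataSeminorm_single_le_one (i : Fin m) :
    dataSeminorm x u (pair 0 (EuclideanSpace.single i 1)) ≤ 1 := by
  have h : ∀ t, generator x u t (pair 0 (EuclideanSpace.single i 1)) =
      u t i / l1Norm fun s => u s i := fun t => by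
    simp [generator_pair, colNormalize, dataMatrix]
  simp only [dataSeminorm_apply, h, abs_div, ← Finset.sum_div, ← l1Norm_eq_sum]
  rw [abs_of_nonneg (show 0 ≤ l1Norm fun s => u s i from norm_nonneg _)]
  exact div_self_le_one _

variable {x u}

/-- Where the support function exceeds `‖v‖` except on the axes `ℝ (0, eᵢ)`, it does so with a
quadratic margin in `w`. Near an axis this follows from the linear growth of the polyhedral
function `σ` along `{p | pᵢ = 0}`; the part of the unit sphere outside these cones is compact. -/
theorem exists_quadratic_margin
    (hstrict : ∀ w v, dataSeminorm x u (pair w v) ≤ ‖v‖ → w = 0 ∧ l0 v ≤ 1)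
    (hone : ∀ i, dataSeminorm x u (pair 0 (EuclideanSpace.single i 1)) = 1) :
    ∃ δ > 0, ∀ w v, ‖v‖ ^ 2 + δ * ‖w‖ ^ 2 ≤ dataSeminorm x u (pair w v) ^ 2 := by
  let e : Fin m → EuclideanSpace ℝ (Fin n ⊕ Fin m) := fun i => pair 0 (EuclideanSpace.single i 1)
  let H : Fin m → Submodule ℝ (EuclideanSpace ℝ (Fin n ⊕ Fin m)) := fun i =>
    LinearMap.ker (EuclideanSpace.proj (Sum.inr i) :
      EuclideanSpace ℝ (Fin n ⊕ Fin m) →L[ℝ] ℝ).toLinearMap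
  have hmemH : ∀ i q, q ∈ H i ↔ q (Sum.inr i) = 0 := fun i q => by simp [H]
  have hgrowth : ∀ i, ∃ c > 0, ∀ s : ℝ, ∀ q ∈ H i,
      s + c * ‖q‖ ≤ dataSeminorm x u (s • e i + q) := fun i => by
    obtain ⟨c, hc, h⟩ := exists_linear_growth (generator x u) (e i) (H i) (fun q hq hq0 => by
      rw [← dataSeminorm_apply, ← dataSeminorm_apply, hone i]
      by_contra! hle
      obtain ⟨w, v, rfl⟩ := exists_eq_pair q
      rw [hmemH, pair_inr] at hq
      rw [← pair_add, zero_add] at hle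
      have hvi : (EuclideanSpace.single i (1 : ℝ) + v) i = 1 := by simp [hq]
      have hnorm : 1 ≤ ‖EuclideanSpace.single i (1 : ℝ) + v‖ := by
        simpa [hq] using PiLp.norm_apply_le (EuclideanSpace.single i (1 : ℝ) + v) i
      obtain ⟨rfl, h0⟩ := hstrict _ _ (hle.trans hnorm)
      obtain ⟨k, r, hk⟩ := (l0_le_one_iff i.pos _).1 h0
      have hik : i = k := by
        by_contra hne
        rw [hk] at hvi
        simp [hne] at hvi
      subst hik
      have hr : r = 1 := by
        rw [hk] at hvi
        simpa using hvi
      apply hq0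
      rw [hr, one_smul, add_eq_left] at hk
      rw [hk, pair_zero_zero])
    refine ⟨c, hc, fun s q hq => ?_⟩
    have h1 := h s q hq
    rw [← dataSeminorm_apply, ← dataSeminorm_apply, hone i, mul_one] at h1
    exact h1
  choose c hc hgrow using hgrowth
  -- the component of `p` orthogonal to the axis `ℝ (0, eᵢ)`
  let r : Fin m → EuclideanSpace ℝ (Fin n ⊕ Fin m) → EuclideanSpace ℝ (Fin n ⊕ Fin m) :=
    fun i p => p - p (Sum.inr i) • e i
  have hrH : ∀ i p, r i p ∈ H i := fun i p => by simp [hmemH, r, e]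
  have hrp : ∀ i p, p (Sum.inr i) • e i + r i p = p := fun i p => by simp [r]
  have hcone : ∀ i p, 0 ≤ p (Sum.inr i) → ‖r i p‖ ≤ 2 * c i * p (Sum.inr i) →
      ‖p‖ ^ 2 ≤ dataSeminorm x u p ^ 2 := fun i p h0 hp => by
    have h1 := hgrow i (p (Sum.inr i)) (r i p) (hrH i p)
    have hinner : inner ℝ (p (Sum.inr i) • e i) (r i p) = 0 := by
      simp [PiLp.inner_apply, Fintype.sum_sum_type, r, e]
    have hpyth : ‖p‖ ^ 2 = p (Sum.inr i) ^ 2 + ‖r i p‖ ^ 2 := by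
      conv_lhs => rw [← hrp i p]
      rw [norm_add_sq_real, hinner, norm_smul, mul_pow, norm_pair_sq]
      simp
    rw [hrp] at h1
    have h2 : 0 ≤ p (Sum.inr i) + c i * ‖r i p‖ := by have := hc i; positivity
    have h3 := pow_le_pow_left₀ h2 h1 2
    nlinarith [norm_nonneg (r i p), sq_nonneg (c i * ‖r i p‖)]
  have hcone' : ∀ i p, ‖r i p‖ ≤ 2 * c i * |p (Sum.inr i)| →
      ‖p‖ ^ 2 ≤ dataSeminorm x u p ^ 2 := fun i p hp => by
    rcases le_total 0 (p (Sum.inr i)) with h0 | h0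
    · exact hcone i p h0 (by rwa [abs_of_nonneg h0] at hp)
    · have hneg : r i (-p) = -r i p := by simp [r]; abel
      have := hcone i (-p) (by simpa using h0) (by
        rw [abs_of_nonpos h0] at hp
        simpa [hneg] using hp)
      simpa [map_neg_eq_map] using this
  let V : EuclideanSpace ℝ (Fin n ⊕ Fin m) → EuclideanSpace ℝ (Fin m) :=
    fun p => WithLp.toLp 2 fun i => p (Sum.inr i)
  have hV : Continuous V := (PiLp.continuous_toLp 2 _).comp (by fun_prop)
  have hVpair : ∀ w v, V (pair w v) = v := fun w v => rfl
  let K : Set (EuclideanSpace ℝ (Fin n ⊕ Fin m)) :=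
    {p | ∀ i, 2 * c i * |p (Sum.inr i)| ≤ ‖r i p‖}
  have hK : IsClosed K := by
    simp only [K, Set.ofPred_forall]
    exact isClosed_iInter fun i => isClosed_le (by fun_prop) (by fun_prop)
  have hS := continuous_dataSeminorm x u
  obtain ⟨ε, hε, hmargin⟩ := ((isCompact_sphere (0 : EuclideanSpace ℝ (Fin n ⊕ Fin m))
    1).inter_right hK).exists_forall_le' (a := 0)
    (f := fun p => dataSeminorm x u p ^ 2 - ‖V p‖ ^ 2) (by fun_prop) (fun p hp => by
      obtain ⟨hp1, hpK⟩ := hp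
      obtain ⟨w, v, rfl⟩ := exists_eq_pair p
      rw [hVpair, sub_pos]
      refine pow_lt_pow_left₀ ?_ (norm_nonneg _) two_ne_zero
      by_contra! hle
      obtain ⟨rfl, h0⟩ := hstrict w v hle
      rcases m.eq_zero_or_pos with hm0 | hm
      · subst hm0
        have : v = 0 := Subsingleton.elim _ _
        simp [this] at hp1
      obtain ⟨i, s, rfl⟩ := (l0_le_one_iff hm v).1 h0
      have hs : s ≠ 0 := by
        rintro rfl
        simp at hp1
      have h1 := hpK i
      have h2 : r i (pair 0 (s • EuclideanSpace.single i 1)) = 0 := by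
        simp [r, e, smul_pair]
      rw [h2] at h1
      simp at h1
      have := mul_pos (hc i) (abs_pos.2 hs)
      linarith)
  refine ⟨min ε 1, lt_min hε one_pos, fun w v => ?_⟩
  obtain ⟨p, hp⟩ : ∃ p, p = pair w v := ⟨_, rfl⟩
  have hw : ‖p‖ ^ 2 = ‖w‖ ^ 2 + ‖V p‖ ^ 2 := by rw [hp, hVpair, norm_pair_sq]
  have hv : v = V p := by rw [hp, hVpair]
  rw [← hp, hv]
  have hmin1 := min_le_right ε 1
  have hmin2 := min_le_left ε 1
  have hw0 := sq_nonneg ‖w‖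
  by_cases hpK : p ∈ K
  · rcases eq_or_ne p 0 with h0 | h0
    · rw [h0] at hw ⊢
      have h3 : ‖V 0‖ ^ 2 = 0 := by rw [show V 0 = 0 from rfl]; simp
      have h4 : ‖w‖ ^ 2 = 0 := by simpa [h3] using hw.symm
      simp [h3, h4]
    have hpos : 0 < ‖p‖ := norm_pos_iff.2 h0
    have hVs : V (‖p‖⁻¹ • p) = ‖p‖⁻¹ • V p := rfl
    have hrs : ∀ i, r i (‖p‖⁻¹ • p) = ‖p‖⁻¹ • r i p := fun i => by
      simp [r, smul_sub, smul_smul]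
    have h1 := hmargin (‖p‖⁻¹ • p) ⟨by simp [norm_smul, hpos.ne'], fun i => by
      have := mul_le_mul_of_nonneg_left (hpK i) (inv_nonneg.2 hpos.le)
      rw [hrs, norm_smul]
      simp only [PiLp.smul_apply, smul_eq_mul, abs_mul, norm_inv, norm_norm, abs_inv, abs_norm]
      linarith⟩
    simp only [hVs, norm_smul, map_smul_eq_mul, norm_inv, norm_norm, mul_pow, ← mul_sub] at h1
    rw [inv_pow, inv_mul_eq_div, le_div_iff₀ (by positivity)] at h1
    nlinarith [sq_nonneg ‖V p‖]
  · simp only [K, Set.mem_ofPred_eq, not_forall, not_le] at hpK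
    obtain ⟨i, hi⟩ := hpK
    have := hcone' i p hi.le
    nlinarith

end

/-! ### The characterization -/

variable {T n m : ℕ} {x : Fin T → EuclideanSpace ℝ (Fin n)} {u : Fin T → EuclideanSpace ℝ (Fin m)}

/-- Persistence of scattering in terms of the support functions: `‖D q‖ ≤ σ(q)`, with equality
at the nonzero `q` whose contact points `D² q / ‖D q‖` are the points `(0, ±eᵢ)`. -/
theorem persistentlyScattering_iff : PersistentlyScattering x u ↔
    ∃ d : Fin n ⊕ Fin m → ℝ, (∀ k, d k ≠ 0) ∧
      (∀ q, ‖Matrix.toEuclideanLin (Matrix.diagonal d) q‖ ≤ dataSeminorm x u q) ∧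
      ∀ p, (∃ q, q ≠ 0 ∧ dataSeminorm x u q = ‖Matrix.toEuclideanLin (Matrix.diagonal d) q‖ ∧
          p = ‖Matrix.toEuclideanLin (Matrix.diagonal d) q‖⁻¹ •
            Matrix.toEuclideanLin (Matrix.diagonal d)
              (Matrix.toEuclideanLin (Matrix.diagonal d) q)) ↔
        ∃ i : Fin m, p = pair 0 (EuclideanSpace.single i 1) ∨
          p = pair 0 (-EuclideanSpace.single i 1) := by
  have hcontact := fun {d : Fin n ⊕ Fin m → ℝ} (hd : ∀ k, d k ≠ 0)
      (hle : ∀ q, ‖Matrix.toEuclideanLin (Matrix.diagonal d) q‖ ≤ dataSeminorm x u q) {p} =>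
    mem_image_closedBall_inter_frontier_iff (p := p) (convex_zonotope x u) (isClosed_zonotope x u)
      (isGreatest_dataSeminorm x u) (isSymmetric_toEuclideanLin_diagonal d)
      (injective_toEuclideanLin_diagonal hd) hle
  have hsub := fun d : Fin n ⊕ Fin m → ℝ =>
    image_closedBall_subset_iff (convex_zonotope x u) (isClosed_zonotope x u)
      (isGreatest_dataSeminorm x u) (isSymmetric_toEuclideanLin_diagonal d)
  have hunit : ∀ d : Fin n ⊕ Fin m → ℝ, IsUnit (Matrix.diagonal d) ↔ ∀ k, d k ≠ 0 := fun d => by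
    rw [Matrix.isUnit_diagonal, Pi.isUnit_iff]
    simp only [isUnit_iff_ne_zero]
  constructor
  · rintro ⟨D, hdiag, hD, hZ, hfr⟩
    obtain ⟨d, rfl⟩ : ∃ d, Matrix.diagonal d = D := ⟨_, hdiag.diagonal_diag⟩
    rw [hunit] at hD
    rw [hsub] at hZ
    exact ⟨d, hD, hZ, fun p => by rw [← hcontact hD hZ, hfr]; rfl⟩
  · rintro ⟨d, hd, hle, h⟩
    exact ⟨Matrix.diagonal d, Matrix.isDiag_diagonal d, (hunit d).2 hd, (hsub d).2 hle,
      Set.ext fun p => by rw [hcontact hd hle, h]; rfl⟩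

/-- Coercivity in `w` makes the infimum defining `Ω(v)` a minimum. -/
theorem exists_Omega_eq {d : Fin n ⊕ Fin m → ℝ} (hd : ∀ k, d k ≠ 0)
    (hle : ∀ q, ‖Matrix.toEuclideanLin (Matrix.diagonal d) q‖ ≤ dataSeminorm x u q)
    (v : EuclideanSpace ℝ (Fin m)) : ∃ w, Omega x u v = dataSeminorm x u (pair w v) := by
  obtain ⟨K, hK, hanti⟩ := LinearMap.exists_antilipschitzWith
    (Matrix.toEuclideanLin (Matrix.diagonal d))
    (LinearMap.ker_eq_bot.2 (injective_toEuclideanLin_diagonal hd))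
  have hcoer : ∀ w, (K : ℝ)⁻¹ * ‖w‖ ≤ dataSeminorm x u (pair w v) := fun w => by
    have h1 : ‖pair w v‖ ≤ K * ‖Matrix.toEuclideanLin (Matrix.diagonal d) (pair w v)‖ := by
      simpa using hanti.le_mul_dist (pair w v) 0
    have h2 : ‖w‖ ≤ ‖pair w v‖ := by
      refine le_of_sq_le_sq ?_ (norm_nonneg _)
      rw [norm_pair_sq]
      exact le_add_of_nonneg_right (sq_nonneg _)
    rw [inv_mul_le_iff₀ (by exact_mod_cast hK)]
    exact (h2.trans h1).trans (by gcongr; exact hle _)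
  have hcont : Continuous fun w => dataSeminorm x u (pair w v) :=
    (continuous_dataSeminorm x u).comp (continuous_pair_left v)
  obtain ⟨w, hw⟩ := hcont.exists_forall_le (Filter.tendsto_atTop_mono hcoer
    ((tendsto_norm_cocompact_atTop).const_mul_atTop (by positivity)))
  refine ⟨w, le_antisymm (Omega_le_dataSeminorm x u w v) (le_ciInf fun w' => ?_)⟩
  rw [sigma_eq_dataSeminorm]
  exact hw w'

/-- The contact points `(0, eᵢ)` force the axes of the ellipsoid in the `v`-coordinates to have
length `1`. -/
theorem sq_eq_one_and_dataSeminorm_single_of_contact {d : Fin n ⊕ Fin m → ℝ}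
    (hd : ∀ k, d k ≠ 0) {i : Fin m} {q : EuclideanSpace ℝ (Fin n ⊕ Fin m)}
    (hq : q ≠ 0) (hSq : dataSeminorm x u q = ‖Matrix.toEuclideanLin (Matrix.diagonal d) q‖)
    (hcontact : pair 0 (EuclideanSpace.single i 1) =
      ‖Matrix.toEuclideanLin (Matrix.diagonal d) q‖⁻¹ • Matrix.toEuclideanLin (Matrix.diagonal d)
        (Matrix.toEuclideanLin (Matrix.diagonal d) q)) :
    d (Sum.inr i) ^ 2 = 1 ∧ dataSeminorm x u (pair 0 (EuclideanSpace.single i 1)) = 1 := by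
  set L := Matrix.toEuclideanLin (Matrix.diagonal d)
  have hpos : 0 < ‖L q‖ := norm_pos_iff.2 fun h =>
    hq (injective_toEuclideanLin_diagonal hd (by simpa using h))
  have hcoord : ∀ k, d k ^ 2 * q k =
      ‖L q‖ * pair (0 : EuclideanSpace ℝ (Fin n)) (EuclideanSpace.single i (1 : ℝ)) k := fun k => by
    rw [hcontact]
    simp only [PiLp.smul_apply, smul_eq_mul, L, toEuclideanLin_diagonal_apply]
    rw [mul_inv_cancel_left₀ hpos.ne']
    ring
  obtain ⟨w, v, rfl⟩ := exists_eq_pair q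
  have hw : w = 0 := by
    ext j
    simpa [hd] using hcoord (Sum.inl j)
  have hv : v = v i • EuclideanSpace.single i 1 := by
    ext k
    by_cases hk : k = i
    · simp [hk]
    · simpa [hd, hk] using hcoord (Sum.inr k)
  have hi : d (Sum.inr i) ^ 2 * v i = ‖L (pair w v)‖ := by
    simpa using hcoord (Sum.inr i)
  have hsq : ‖L (pair w v)‖ ^ 2 = d (Sum.inr i) ^ 2 * v i ^ 2 := by
    rw [norm_toEuclideanLin_diagonal_pair_sq, hw, Finset.sum_eq_single i]
    · simp
    · intro k _ hk
      rw [hv]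
      simp [hk]
    · simp
  have hvi : v i ≠ 0 := by
    intro h0
    rw [h0, mul_zero] at hi
    exact hpos.ne hi
  have h1 : d (Sum.inr i) ^ 2 = 1 := by
    rw [← hi] at hsq
    have h2 : d (Sum.inr i) ^ 2 * v i ^ 2 ≠ 0 := mul_ne_zero (pow_ne_zero 2 (hd _)) (by positivity)
    apply mul_right_cancel₀ h2
    linear_combination hsq
  refine ⟨h1, ?_⟩
  rw [h1, one_mul] at hi
  have hvpos : 0 < v i := hi ▸ hpos
  rw [← hi] at hSq
  have h3 : pair w v = v i • pair 0 (EuclideanSpace.single i 1) := by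
    rw [smul_pair, smul_zero, ← hv, hw]
  rw [h3, map_smul_eq_mul, Real.norm_of_nonneg hvpos.le] at hSq
  exact mul_left_cancel₀ hvpos.ne' (hSq.trans (mul_one _).symm)

/-- Necessity of the three conditions. -/
theorem PersistentlyScattering.conditions (hm : 0 < m) (h : PersistentlyScattering x u) :
    (∀ v, ‖v‖ ≤ Omega x u v) ∧ (∀ v, Omega x u v = ‖v‖ ↔ l0 v ≤ 1) ∧
      ∀ (i : Fin m) (w : EuclideanSpace ℝ (Fin n)), Omega x u (EuclideanSpace.single i 1) =
        sigma x u w (EuclideanSpace.single i 1) → w = 0 := by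
  obtain ⟨d, hd, hle, hfr⟩ := persistentlyScattering_iff.1 h
  have haxis : ∀ i, d (Sum.inr i) ^ 2 = 1 ∧
      dataSeminorm x u (pair 0 (EuclideanSpace.single i 1)) = 1 := fun i => by
    obtain ⟨q, hq, hSq, hp⟩ := (hfr _).2 ⟨i, Or.inl rfl⟩
    exact sq_eq_one_and_dataSeminorm_single_of_contact hd hq hSq hp
  have hnorm : ∀ w v, ‖Matrix.toEuclideanLin (Matrix.diagonal d) (pair w v)‖ ^ 2 =
      ∑ j, d (Sum.inl j) ^ 2 * w j ^ 2 + ‖v‖ ^ 2 := fun w v => by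
    rw [norm_toEuclideanLin_diagonal_pair_sq, EuclideanSpace.real_norm_sq_eq v]
    simp [haxis]
  have hsum : ∀ w : EuclideanSpace ℝ (Fin n), 0 ≤ ∑ j, d (Sum.inl j) ^ 2 * w j ^ 2 := fun w =>
    Finset.sum_nonneg fun j _ => by positivity
  have hge : ∀ w v, ‖v‖ ≤ ‖Matrix.toEuclideanLin (Matrix.diagonal d) (pair w v)‖ := fun w v =>
    le_of_sq_le_sq (by linarith [hnorm w v, hsum w]) (norm_nonneg _)
  have hzero : ∀ w v, dataSeminorm x u (pair w v) = ‖v‖ → w = 0 := fun w v hwv => by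
    have h1 := le_antisymm (hge w v) ((hle _).trans_eq hwv)
    have h2 := hnorm w v
    rw [← h1, right_eq_add, Finset.sum_eq_zero_iff_of_nonneg fun j _ => by positivity] at h2
    ext j
    simpa [hd] using h2 j (Finset.mem_univ j)
  have hOmega : ∀ v, ‖v‖ ≤ Omega x u v := fun v => by
    obtain ⟨w, hw⟩ := exists_Omega_eq hd hle v
    rw [hw]
    exact (hge w v).trans (hle _)
  have hOmega_axis : ∀ (i : Fin m) (c : ℝ), Omega x u (c • EuclideanSpace.single i 1) =
      ‖c • (EuclideanSpace.single i 1 : EuclideanSpace ℝ (Fin m))‖ := fun i c => by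
    refine le_antisymm ((Omega_le_dataSeminorm x u 0 _).trans_eq ?_) (hOmega _)
    have h1 : pair (0 : EuclideanSpace ℝ (Fin n)) (c • EuclideanSpace.single i (1 : ℝ)) =
        c • pair 0 (EuclideanSpace.single i 1) := by rw [smul_pair, smul_zero]
    rw [h1, map_smul_eq_mul, (haxis i).2, norm_smul]
    simp
  refine ⟨hOmega, fun v => ?_, fun i w hw => ?_⟩
  · rw [l0_le_one_iff hm]
    constructor
    · intro hv
      rcases eq_or_ne v 0 with rfl | hv0
      · exact ⟨⟨0, hm⟩, 0, by simp⟩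
      have hvpos : ‖v‖ ≠ 0 := norm_ne_zero_iff.2 hv0
      obtain ⟨w, hw⟩ := exists_Omega_eq hd hle v
      obtain rfl := hzero w v (hw.symm.trans hv)
      have h1 : ‖Matrix.toEuclideanLin (Matrix.diagonal d) (pair 0 v)‖ = ‖v‖ :=
        le_antisymm ((hle _).trans_eq (hw.symm.trans hv)) (hge 0 v)
      have hne : pair (0 : EuclideanSpace ℝ (Fin n)) v ≠ 0 := fun h0 => by
        rw [h0, map_zero, norm_zero] at h1
        exact hvpos h1.symm
      have hp : ‖Matrix.toEuclideanLin (Matrix.diagonal d) (pair 0 v)‖⁻¹ •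
          Matrix.toEuclideanLin (Matrix.diagonal d)
            (Matrix.toEuclideanLin (Matrix.diagonal d) (pair 0 v)) =
          pair (0 : EuclideanSpace ℝ (Fin n)) (‖v‖⁻¹ • v) := by
        rw [h1]
        ext (j | i)
        · simp [toEuclideanLin_diagonal_apply]
        · simp [toEuclideanLin_diagonal_apply, ← mul_assoc (d _) (d _), ← sq, haxis]
      obtain ⟨i, hi⟩ := (hfr _).1 ⟨pair 0 v, hne, by rw [← hw, hv, h1], hp.symm⟩
      have hinj : ∀ {a b : EuclideanSpace ℝ (Fin m)},
          pair (0 : EuclideanSpace ℝ (Fin n)) a = pair 0 b → a = b := fun {a b} hab => by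
        ext k
        exact congrArg (fun p => p (Sum.inr k)) hab
      rcases hi with hi | hi
      · exact ⟨i, ‖v‖, by rw [← hinj hi, smul_inv_smul₀ hvpos]⟩
      · exact ⟨i, -‖v‖, by rw [neg_smul, ← smul_neg, ← hinj hi, smul_inv_smul₀ hvpos]⟩
    · rintro ⟨i, c, rfl⟩
      exact hOmega_axis i c
  · rw [sigma_eq_dataSeminorm] at hw
    have h1 := hOmega_axis i 1
    rw [one_smul] at h1
    exact hzero w _ (hw.symm.trans h1)

/-- Sufficiency of the three conditions. -/
theorem persistentlyScattering_of_conditions (hm : 0 < m)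
    (h1 : ∀ v, ‖v‖ ≤ Omega x u v) (h2 : ∀ v, Omega x u v = ‖v‖ ↔ l0 v ≤ 1)
    (h3 : ∀ (i : Fin m) (w : EuclideanSpace ℝ (Fin n)), Omega x u (EuclideanSpace.single i 1) =
      sigma x u w (EuclideanSpace.single i 1) → w = 0) : PersistentlyScattering x u := by
  have hOmega : ∀ i, Omega x u (EuclideanSpace.single i 1) = 1 := fun i => by
    rw [(h2 _).2 ((l0_le_one_iff hm _).2 ⟨i, 1, (one_smul _ _).symm⟩)]
    simp
  have hone : ∀ i, dataSeminorm x u (pair 0 (EuclideanSpace.single i 1)) = 1 := fun i =>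
    le_antisymm (dataSeminorm_single_le_one x u i)
      ((hOmega i).symm.le.trans (Omega_le_dataSeminorm x u 0 _))
  have hzero : ∀ i w, dataSeminorm x u (pair w (EuclideanSpace.single i 1)) ≤ 1 → w = 0 :=
    fun i w hw => h3 i w (by
      rw [sigma_eq_dataSeminorm]
      exact le_antisymm (Omega_le_dataSeminorm x u w _) (hw.trans (hOmega i).symm.le))
  have hstrict : ∀ w v, dataSeminorm x u (pair w v) ≤ ‖v‖ → w = 0 ∧ l0 v ≤ 1 := fun w v hwv => by
    have h0 : l0 v ≤ 1 :=
      (h2 v).1 (le_antisymm ((Omega_le_dataSeminorm x u w v).trans hwv) (h1 v))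
    refine ⟨?_, h0⟩
    obtain ⟨i, c, rfl⟩ := (l0_le_one_iff hm v).1 h0
    rcases eq_or_ne c 0 with rfl | hc
    · -- here `σ(w, 0) = 0`, so `w` is also a minimizer for `eᵢ`
      apply hzero i w
      have hsplit : pair w (EuclideanSpace.single i (1 : ℝ)) =
          pair w ((0 : ℝ) • EuclideanSpace.single i (1 : ℝ)) +
            pair 0 (EuclideanSpace.single i 1) := by
        rw [← pair_add]
        simp
      rw [hsplit]
      refine (map_add_le_add _ _ _).trans ?_
      rw [hone]
      simpa using hwv
    · have hscale : pair w (c • EuclideanSpace.single i (1 : ℝ)) =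
          c • pair (c⁻¹ • w) (EuclideanSpace.single i 1) := by
        rw [smul_pair, smul_inv_smul₀ hc]
      rw [hscale, map_smul_eq_mul, norm_smul] at hwv
      have h4 := hzero i (c⁻¹ • w) (le_of_mul_le_mul_left (by simpa using hwv) (norm_pos_iff.2 hc))
      simpa [hc] using h4
  obtain ⟨δ, hδ, hmargin⟩ := exists_quadratic_margin hstrict hone
  -- halving the margin makes the inequality strict for `w ≠ 0`
  let d : Fin n ⊕ Fin m → ℝ := Sum.elim (fun _ => √(δ / 2)) (fun _ => 1)
  have hd : ∀ k, d k ≠ 0 := by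
    rintro (j | i)
    · exact (Real.sqrt_pos.2 (half_pos hδ)).ne'
    · exact one_ne_zero
  have hnorm : ∀ w v, ‖Matrix.toEuclideanLin (Matrix.diagonal d) (pair w v)‖ ^ 2 =
      δ / 2 * ‖w‖ ^ 2 + ‖v‖ ^ 2 := fun w v => by
    rw [norm_toEuclideanLin_diagonal_pair_sq, EuclideanSpace.real_norm_sq_eq w,
      EuclideanSpace.real_norm_sq_eq v]
    simp only [d, Sum.elim_inl, Sum.elim_inr, Real.sq_sqrt (half_pos hδ).le, one_pow, one_mul,
      Finset.mul_sum]
  have haxis : ∀ a : EuclideanSpace ℝ (Fin m), Matrix.toEuclideanLin (Matrix.diagonal d)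
      (pair (0 : EuclideanSpace ℝ (Fin n)) a) = pair 0 a := fun a => by
    ext (j | i) <;> simp [toEuclideanLin_diagonal_apply, d]
  have hnorm_axis : ∀ a : EuclideanSpace ℝ (Fin m), ‖pair (0 : EuclideanSpace ℝ (Fin n)) a‖ = ‖a‖ :=
    fun a => by
      rw [← sq_eq_sq₀ (norm_nonneg _) (norm_nonneg _), norm_pair_sq]
      simp
  refine persistentlyScattering_iff.2 ⟨d, hd, fun q => ?_, fun p => ⟨?_, ?_⟩⟩
  · obtain ⟨w, v, rfl⟩ := exists_eq_pair q
    refine le_of_sq_le_sq ?_ (apply_nonneg _ _)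
    rw [hnorm]
    nlinarith [hmargin w v, sq_nonneg ‖w‖]
  · rintro ⟨q, hq, hSq, rfl⟩
    obtain ⟨w, v, rfl⟩ := exists_eq_pair q
    have h4 : δ / 2 * ‖w‖ ^ 2 ≤ 0 := by
      have := hmargin w v
      rw [hSq, hnorm] at this
      linarith
    have hw : w = 0 := by
      by_contra hne
      have := norm_pos_iff.2 hne
      have : 0 < δ / 2 * ‖w‖ ^ 2 := by positivity
      linarith
    subst hw
    rw [haxis, hnorm_axis] at hSq
    obtain ⟨i, c, rfl⟩ := (l0_le_one_iff hm v).1 (hstrict 0 v hSq.le).2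
    have hc : c ≠ 0 := by
      rintro rfl
      simp at hq
    refine ⟨i, ?_⟩
    rw [haxis, haxis, hnorm_axis, smul_pair, smul_zero, norm_smul, smul_smul]
    rcases lt_or_gt_of_ne hc with h | h
    · right
      simp [abs_of_neg h, inv_neg, inv_mul_cancel₀ hc]
    · left
      simp [abs_of_pos h, inv_mul_cancel₀ hc]
  · have hS_neg : ∀ i, dataSeminorm x u (pair 0 (-EuclideanSpace.single i 1)) = 1 := fun i => by
      have h4 : pair (0 : EuclideanSpace ℝ (Fin n)) (-EuclideanSpace.single i (1 : ℝ)) =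
          -pair 0 (EuclideanSpace.single i 1) := by
        ext (j | k) <;> simp
      rw [h4, map_neg_eq_map, hone]
    have hcontact : ∀ a : EuclideanSpace ℝ (Fin m), ‖a‖ = 1 →
        dataSeminorm x u (pair 0 a) = 1 → ∃ q, q ≠ 0 ∧
          dataSeminorm x u q = ‖Matrix.toEuclideanLin (Matrix.diagonal d) q‖ ∧
          pair 0 a = ‖Matrix.toEuclideanLin (Matrix.diagonal d) q‖⁻¹ •
            Matrix.toEuclideanLin (Matrix.diagonal d)
              (Matrix.toEuclideanLin (Matrix.diagonal d) q) := fun a ha hS => by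
      refine ⟨pair 0 a, ?_, ?_, ?_⟩
      · rw [← norm_ne_zero_iff, hnorm_axis, ha]
        exact one_ne_zero
      · rw [haxis, hnorm_axis, ha, hS]
      · rw [haxis, haxis, hnorm_axis, ha, inv_one, one_smul]
    rintro ⟨i, rfl | rfl⟩
    · exact hcontact _ (by simp) (hone i)
    · exact hcontact _ (by simp) (hS_neg i)

end PersistentScattering

theorem proposition1 {T n m : ℕ} (hm : 0 < m)
    (x : Fin T → EuclideanSpace ℝ (Fin n)) (u : Fin T → EuclideanSpace ℝ (Fin m)) :
    PersistentScattering.PersistentlyScattering x u ↔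
      (∀ v : EuclideanSpace ℝ (Fin m), ‖v‖ ≤ PersistentScattering.Omega x u v) ∧
      (∀ v : EuclideanSpace ℝ (Fin m),
        PersistentScattering.Omega x u v = ‖v‖ ↔ PersistentScattering.l0 v ≤ 1) ∧
      (∀ (i : Fin m) (w : EuclideanSpace ℝ (Fin n)),
        PersistentScattering.Omega x u (EuclideanSpace.single i 1) =
          PersistentScattering.sigma x u w (EuclideanSpace.single i 1) → w = 0) :=
  ⟨fun h => h.conditions hm, fun h =>
    PersistentScattering.persistentlyScattering_of_conditions hm h.1 h.2.1 h.2.2⟩
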